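/- A skew (left) brace is a set $B$ with two group structures $(B,+)$ and $(B,\cdot)$, neither assumed abelian, such that $a(b+c)=ab-a+ac$ for all $a,b,c\in B$; put $\lambda_a(b)=-a+ab$. The two groups have the same identity $0$. An ideal of $B$ is a subset that is a normal subgroup of both $(B,+)$ and $(B,\cdot)$ and is invariant under every $\lambda_b$, $b\in B$; an ideal $I$ is itself a skew brace, and $B/I$ is a skew brace. Let $\operatorname{Soc}(B)=\operatorname{Ker}\lambda\cap Z(B,+)$ and $\zeta(B)=\operatorname{Soc}(B)\cap Z(B,\cdot)$. The skew brace $B$ is supersoluble if it has a finite chain of ideals $\{0\}=I_0\le I_1\le\dots\le I_n=B$ such that, for each $0\le i<n$, either $(I_{i+1}/I_i,+)$ is infinite cyclic and $I_{i+1}/I_i\le\operatorname{Soc}(B/I_i)$, or $I_{i+1}/I_i$ has prime order. An ideal $I$ of $B$ is $B$-centrally nilpotent if there is a finite chain of ideals of $B$, $\{0\}=I_0\le I_1\le\dots\le I_n=I$, with $I_{i+1}/I_i\le\zeta(I/I_i)$ for all $0\le i<n$. The Fitting ideal $\operatorname{Fit}(B)$ is the sum of all $B$-centrally nilpotent ideals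 of $B$. Let $U_2^+(B)$ be the set of all elements of finite odd order in $(B,+)$. **Theorem.** Let $B$ be a supersoluble skew brace such that $U_2^+(B)=\{0\}$. Then $B/\operatorname{Fit}(B)$ is finite and $|B/\operatorname{Fit}(B)|$ is a power of $2$. In particular, this holds if $B$ is supersoluble and $(B,+)$ is torsion-free (that is, $0$ is its only element of finite order). -/

import Mathlib

/-- A skew left brace: a set with two group structures `(B, +)` (not necessarily abelian) and
`(B, *)` such that `a * (b + c) = a * b - a + a * c`. -/
class SkewBrace (B : Type*) extends AddGroup B, Group B where
  mul_add_eq : ∀ a b c : B, a * (b + c) = a * b - a + a * c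

namespace SkewBrace

section Basic

variable {B : Type*} [SkewBrace B]

/-- The map `lam a b = -a + a * b`, usually written `λ_a(b)`. -/
def lam (a b : B) : B := -a + a * b

theorem mul_eq_add_lam (a b : B) : a * b = a + lam a b := by
  simp [lam]

theorem one_eq_zero : (1 : B) = 0 := by
  have h := mul_add_eq (1 : B) 0 0
  simp only [add_zero, one_mul, zero_sub] at h
  exact neg_eq_zero.mp h.symm

theorem lam_add (a b c : B) : lam a (b + c) = lam a b + lam a c := by
  simp only [lam, mul_add_eq, sub_eq_add_neg, add_assoc]

theorem mul_zero_eq (a : B) : a * (0 : B) = a := by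
  rw [← one_eq_zero, mul_one]

theorem lam_zero (a : B) : lam a (0 : B) = 0 := by
  simp [lam, mul_zero_eq]

theorem lam_neg (a b : B) : lam a (-b) = -lam a b := by
  apply eq_neg_of_add_eq_zero_left
  rw [← lam_add, neg_add_cancel, lam_zero]

theorem lam_mul (a b c : B) : lam (a * b) c = lam a (lam b c) := by
  have h : a * b + lam (a * b) c = a * b + lam a (lam b c) := by
    rw [← mul_eq_add_lam, mul_assoc, mul_eq_add_lam b c, mul_eq_add_lam a (b + _), lam_add,
      ← add_assoc, ← mul_eq_add_lam]
  exact add_left_cancel h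

theorem lam_one (c : B) : lam (1 : B) c = c := by
  simp [lam, one_eq_zero (B := B) ▸ one_mul c, one_eq_zero]

theorem lam_lam_inv (a c : B) : lam a (lam a⁻¹ c) = c := by
  rw [← lam_mul, mul_inv_cancel, lam_one]

theorem inv_eq_lam (a : B) : a⁻¹ = lam a⁻¹ (-a) := by
  have h : a⁻¹ + lam a⁻¹ a = 0 := by
    rw [← mul_eq_add_lam, inv_mul_cancel, one_eq_zero]
  rw [lam_neg]
  exact eq_neg_of_add_eq_zero_left h

theorem add_eq_mul (a b : B) : a + b = a * lam a⁻¹ b := by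
  rw [mul_eq_add_lam, lam_lam_inv]

variable (B) in
/-- The socle `Soc(B) = Ker λ ∩ Z(B, +)`. -/
def socle : Set B := {a | ∀ b : B, lam a b = b} ∩ (AddSubgroup.center B : Set B)

variable (B) in
/-- The centre `ζ(B) = Soc(B) ∩ Z(B, *)`. -/
def zeta : Set B := socle B ∩ (Subgroup.center B : Set B)

variable (B) in
/-- `U_p^+(B)`: the elements whose additive order is finite and divisible only by primes
larger than `p`. -/
def addU (p : ℕ) : Set B :=
  {b | IsOfFinAddOrder b ∧ ∀ q : ℕ, q.Prime → q ∣ addOrderOf b → p < q}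

end Basic

/-- An ideal of a skew brace: a subgroup of `(B, +)` and of `(B, *)` that is normal in both groups
and invariant under all the maps `λ_b`. -/
structure BraceIdeal (B : Type*) [SkewBrace B] extends AddSubgroup B where
  mul_mem : ∀ {a b : B}, a ∈ carrier → b ∈ carrier → a * b ∈ carrier
  inv_mem : ∀ {a : B}, a ∈ carrier → a⁻¹ ∈ carrier
  lam_mem : ∀ (b : B) {a : B}, a ∈ carrier → lam b a ∈ carrier
  add_conj_mem : ∀ (b : B) {a : B}, a ∈ carrier → b + a + -b ∈ carrier
  mul_conj_mem : ∀ (b : B) {a : B}, a ∈ carrier → b * a * b⁻¹ ∈ carrier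

namespace BraceIdeal

variable {B : Type*} [SkewBrace B]

instance : SetLike (BraceIdeal B) B where
  coe I := I.carrier
  coe_injective I J h := by
    cases I; cases J; congr; exact SetLike.coe_injective h

instance : PartialOrder (BraceIdeal B) := PartialOrder.ofSetLike (BraceIdeal B) B

instance (I : BraceIdeal B) : I.toAddSubgroup.Normal :=
  ⟨fun _ ha b => I.add_conj_mem b ha⟩

/-- The multiplicative subgroup underlying an ideal. -/
def toMulSubgroup (I : BraceIdeal B) : Subgroup B where
  carrier := I.carrier
  mul_mem' := I.mul_mem
  one_mem' := by rw [one_eq_zero]; exact I.zero_mem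
  inv_mem' := I.inv_mem

/-- An ideal is itself a skew brace, with the restricted operations. -/
instance (I : BraceIdeal B) : SkewBrace I where
  toAddGroup := inferInstanceAs (AddGroup I.toAddSubgroup)
  toGroup := inferInstanceAs (Group I.toMulSubgroup)
  mul_add_eq a b c := Subtype.ext (SkewBrace.mul_add_eq (a : B) b c)

/-- `J ∩ I`, as an ideal of the skew brace `I`. -/
def restrict (J I : BraceIdeal B) : BraceIdeal I where
  carrier := {x | (x : B) ∈ J}
  add_mem' := fun ha hb => J.add_mem ha hb
  zero_mem' := J.zero_mem
  neg_mem' := fun ha => J.neg_mem ha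
  mul_mem := fun ha hb => J.mul_mem ha hb
  inv_mem := fun ha => J.inv_mem ha
  lam_mem := fun b _ ha => J.lam_mem (b : B) ha
  add_conj_mem := fun b _ ha => J.add_conj_mem (b : B) ha
  mul_conj_mem := fun b _ ha => J.mul_conj_mem (b : B) ha

/-- The underlying type of the quotient `B / I`: the additive cosets `b + I = bI`. -/
def Quot (I : BraceIdeal B) : Type _ := B ⧸ I.toAddSubgroup

instance (I : BraceIdeal B) : AddGroup I.Quot :=
  inferInstanceAs (AddGroup (B ⧸ I.toAddSubgroup))

/-- The projection `B → B / I`. -/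
def proj (I : BraceIdeal B) : B →+ I.Quot := QuotientAddGroup.mk' I.toAddSubgroup

theorem proj_surjective (I : BraceIdeal B) : Function.Surjective I.proj :=
  QuotientAddGroup.mk'_surjective _

theorem proj_eq_proj (I : BraceIdeal B) {a b : B} : I.proj a = I.proj b ↔ -a + b ∈ I :=
  QuotientAddGroup.eq

/-- Additive cosets and multiplicative cosets of an ideal agree. -/
theorem proj_eq_proj_mul (I : BraceIdeal B) {a b : B} : I.proj a = I.proj b ↔ a⁻¹ * b ∈ I := by
  rw [proj_eq_proj]
  have h : -a + b = lam a (a⁻¹ * b) := by simp [lam]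
  have h2 : a⁻¹ * b = lam a⁻¹ (-a + b) := by
    rw [h, ← lam_mul, inv_mul_cancel, lam_one]
  constructor
  · intro h3; rw [h2]; exact I.lam_mem _ h3
  · intro h3; rw [h]; exact I.lam_mem _ h3

theorem proj_mul_congr (I : BraceIdeal B) {a a' b b' : B} (ha : I.proj a = I.proj a')
    (hb : I.proj b = I.proj b') : I.proj (a * b) = I.proj (a' * b') := by
  rw [proj_eq_proj_mul] at *
  have h : (a * b)⁻¹ * (a' * b') = b⁻¹ * (a⁻¹ * a') * b⁻¹⁻¹ * (b⁻¹ * b') := by group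
  rw [h]
  exact I.mul_mem (I.mul_conj_mem _ ha) hb

theorem proj_inv_congr (I : BraceIdeal B) {a a' : B} (ha : I.proj a = I.proj a') :
    I.proj a⁻¹ = I.proj a'⁻¹ := by
  rw [proj_eq_proj_mul] at *
  have h : a⁻¹⁻¹ * a'⁻¹ = a * (a⁻¹ * a')⁻¹ * a⁻¹ := by group
  rw [h]
  exact I.mul_conj_mem _ (I.inv_mem ha)

instance (I : BraceIdeal B) : Mul I.Quot :=
  ⟨Quotient.map₂ (· * ·) fun _ _ ha _ _ hb =>
    Quotient.exact (I.proj_mul_congr (Quotient.sound ha) (Quotient.sound hb))⟩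

instance (I : BraceIdeal B) : Inv I.Quot :=
  ⟨Quotient.map (·⁻¹) fun _ _ ha => Quotient.exact (I.proj_inv_congr (Quotient.sound ha))⟩

instance (I : BraceIdeal B) : One I.Quot := ⟨I.proj 1⟩

theorem proj_mul (I : BraceIdeal B) (a b : B) : I.proj (a * b) = I.proj a * I.proj b := rfl

theorem proj_inv (I : BraceIdeal B) (a : B) : I.proj a⁻¹ = (I.proj a)⁻¹ := rfl

theorem proj_one (I : BraceIdeal B) : I.proj 1 = 1 := rfl

/-- The quotient skew brace `B / I`. -/
instance (I : BraceIdeal B) : SkewBrace I.Quot where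
  toAddGroup := inferInstance
  toGroup := Group.ofLeftAxioms
    (fun a b c => by
      obtain ⟨a, rfl⟩ := I.proj_surjective a
      obtain ⟨b, rfl⟩ := I.proj_surjective b
      obtain ⟨c, rfl⟩ := I.proj_surjective c
      simp only [← proj_mul, mul_assoc])
    (fun a => by
      obtain ⟨a, rfl⟩ := I.proj_surjective a
      rw [← proj_one, ← proj_mul, one_mul])
    (fun a => by
      obtain ⟨a, rfl⟩ := I.proj_surjective a
      rw [← proj_inv, ← proj_mul, inv_mul_cancel, proj_one])
  mul_add_eq a b c := by
    obtain ⟨a, rfl⟩ := I.proj_surjective a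
    obtain ⟨b, rfl⟩ := I.proj_surjective b
    obtain ⟨c, rfl⟩ := I.proj_surjective c
    change I.proj (a * (b + c)) = I.proj (a * b) - I.proj a + I.proj (a * c)
    rw [SkewBrace.mul_add_eq, map_add, map_sub]

/-- For ideals `I ≤ J`, the additive group of `J / I`, as a subgroup of `(B / I, +)`. -/
def factor (J I : BraceIdeal B) : AddSubgroup I.Quot := J.toAddSubgroup.map I.proj

/-- An ideal `I` is `B`-centrally nilpotent if there is a chain of ideals of `B`
`0 = c 0 ≤ c 1 ≤ ⋯ ≤ c n = I` with `c (i+1) / c i ≤ ζ(I / c i)` for all `i < n`. -/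
def IsBCentrallyNilpotent (I : BraceIdeal B) : Prop :=
  ∃ (n : ℕ) (c : ℕ → BraceIdeal B),
    (c 0 : Set B) = {0} ∧ c n = I ∧
    ∀ i < n, c i ≤ c (i + 1) ∧
      ∀ x : I, (x : B) ∈ c (i + 1) → ((c i).restrict I).proj x ∈ zeta ((c i).restrict I).Quot

variable (B) in
/-- The additive subgroup generated by all the `B`-centrally nilpotent ideals of `B`. -/
def fitAddSubgroup : AddSubgroup B :=
  ⨆ (I : BraceIdeal B) (_ : I.IsBCentrallyNilpotent), I.toAddSubgroup

theorem le_fit {I : BraceIdeal B} (h : I.IsBCentrallyNilpotent) {x : B} (hx : x ∈ I) :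
    x ∈ fitAddSubgroup B :=
  (le_iSup₂_of_le I h le_rfl : I.toAddSubgroup ≤ fitAddSubgroup B) hx

theorem fit_induction {p : B → Prop} (h0 : p 0) (hadd : ∀ x y, p x → p y → p (x + y))
    (hI : ∀ I : BraceIdeal B, I.IsBCentrallyNilpotent → ∀ x ∈ I, p x) {x : B}
    (hx : x ∈ fitAddSubgroup B) : p x := by
  unfold fitAddSubgroup at hx
  rw [iSup_subtype'] at hx
  exact AddSubgroup.iSup_induction (C := p) _ hx (fun I x hx => hI I.1 I.2 x hx) h0 hadd

theorem fit_lam_mem (b : B) {a : B} (ha : a ∈ fitAddSubgroup B) :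
    lam b a ∈ fitAddSubgroup B := by
  refine fit_induction (p := fun a => lam b a ∈ fitAddSubgroup B) ?_ ?_ ?_ ha
  · rw [lam_zero]; exact zero_mem _
  · intro x y hx hy; rw [lam_add]; exact add_mem hx hy
  · intro I h x hx; exact le_fit h (I.lam_mem b hx)

theorem fit_mul_mem {a b : B} (ha : a ∈ fitAddSubgroup B) (hb : b ∈ fitAddSubgroup B) :
    a * b ∈ fitAddSubgroup B := by
  rw [mul_eq_add_lam]; exact add_mem ha (fit_lam_mem a hb)

theorem fit_mul_conj_mem (b : B) {a : B} (ha : a ∈ fitAddSubgroup B) :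
    b * a * b⁻¹ ∈ fitAddSubgroup B := by
  have key : ∀ c : B, b * lam c a * b⁻¹ ∈ fitAddSubgroup B := by
    refine fit_induction (p := fun a => ∀ c : B, b * lam c a * b⁻¹ ∈ fitAddSubgroup B)
      ?_ ?_ ?_ ha
    · intro c
      rw [lam_zero, mul_zero_eq, mul_inv_cancel, one_eq_zero]
      exact zero_mem _
    · intro x y hx hy c
      have h : b * lam c (x + y) * b⁻¹ =
          (b * lam c x * b⁻¹) * (b * lam ((lam c x)⁻¹ * c) y * b⁻¹) := by
        rw [lam_add, add_eq_mul, lam_mul]; group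
      rw [h]
      exact fit_mul_mem (hx c) (hy _)
    · intro I h x hx c
      exact le_fit h (I.mul_conj_mem b (I.lam_mem c hx))
  simpa [lam_one] using key 1

variable (B) in
/-- The Fitting ideal `Fit(B)`: the sum of all the `B`-centrally nilpotent ideals of `B`. -/
def fit : BraceIdeal B where
  toAddSubgroup := fitAddSubgroup B
  mul_mem := fit_mul_mem
  inv_mem := fun {a} ha => by
    rw [inv_eq_lam]; exact fit_lam_mem _ (neg_mem ha)
  lam_mem := fun b _ ha => fit_lam_mem b ha
  add_conj_mem := fun b {a} ha => by
    refine fit_induction (p := fun a => b + a + -b ∈ fitAddSubgroup B) ?_ ?_ ?_ ha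
    · simp
    · intro x y hx hy
      have h : b + (x + y) + -b = (b + x + -b) + (b + y + -b) := by
        simp [add_assoc]
      rw [h]; exact add_mem hx hy
    · intro I h x hx; exact le_fit h (I.add_conj_mem b hx)
  mul_conj_mem := fun b _ ha => fit_mul_conj_mem b ha

end BraceIdeal

/-- A skew brace `B` is supersoluble if it has a finite chain of ideals
`0 = c 0 ≤ c 1 ≤ ⋯ ≤ c n = B` such that, for each `i < n`, either `c (i+1) / c i` has infinite
cyclic additive group and lies in `Soc(B / c i)`, or `c (i+1) / c i` has prime order. -/
def IsSupersoluble (B : Type*) [SkewBrace B] : Prop :=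
  ∃ (n : ℕ) (c : ℕ → BraceIdeal B),
    (c 0 : Set B) = {0} ∧ (c n : Set B) = Set.univ ∧
    ∀ i < n, c i ≤ c (i + 1) ∧
      ((Infinite ((c (i + 1)).factor (c i)) ∧ IsAddCyclic ((c (i + 1)).factor (c i)) ∧
          ((c (i + 1)).factor (c i) : Set (c i).Quot) ⊆ socle (c i).Quot) ∨
        (Nat.card ((c (i + 1)).factor (c i))).Prime)

end SkewBrace

/-! Two facts drive the argument: an ideal of order 2 is central in every sense, and each `λ_b` acts
on an infinite cyclic factor as 1 or -1.

Factors of odd prime order are eliminated from the given chain. Such a factor moves down past a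
factor of order 2 (`exists_swap_two_prime`); at an infinite cyclic factor it either moves past it or
merges with it into a single infinite cyclic factor (`exists_swap_infinite_prime`). If it reached
the bottom, it would give a nonzero element of odd prime order, which the hypothesis forbids. So `B`
has a chain whose factors have order 2, or are infinite cyclic and in the socle.

The elements acting trivially through `λ` on all infinite cyclic factors form a multiplicative
subgroup `H` containing every square. An ideal `N` inside `H` is `B`-centrally nilpotent: intersect
the chain with `N` (`ZTwoChain.exists_stabilizer`). It remains to find such an `N` whose index is a
power of 2 (`ZTwoChain.exists_twoChain_le`). For this, factors of order 2 are pushed to the top: if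
`E` has order 2 and `J / E` is infinite cyclic, the doubles of elements of `J` form an infinite
cyclic ideal in the socle, of index 4 in `J` (`exists_sink_zstep_bot`). Halving each infinite cyclic
factor then keeps `N` inside `H`, because modulo the ideal below, `y + y` is the square `y * y`. -/

namespace SkewBrace

variable {B : Type*} [SkewBrace B]

/-! ### Ideals of quotients and the two kinds of chain step. -/

namespace BraceIdeal

theorem proj_lam (I : BraceIdeal B) (a b : B) :
    I.proj (lam a b) = lam (I.proj a) (I.proj b) := by
  simp [lam, map_add, map_neg, proj_mul]

theorem proj_eq_zero (I : BraceIdeal B) {a : B} : I.proj a = 0 ↔ a ∈ I := by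
  rw [← map_zero I.proj, eq_comm, proj_eq_proj, neg_zero, zero_add]

theorem proj_pow (I : BraceIdeal B) (a : B) (n : ℕ) : I.proj (a ^ n) = I.proj a ^ n := by
  induction n with
  | zero => simp [proj_one]
  | succ n ih => rw [pow_succ, pow_succ, proj_mul, ih]

instance : Bot (BraceIdeal B) where
  bot :=
    { (⊥ : AddSubgroup B) with
      mul_mem := fun {a b} ha hb => by
        obtain rfl : a = 0 := ha
        obtain rfl : b = 0 := hb
        exact mul_zero_eq (0 : B)
      inv_mem := fun {a} ha => by
        obtain rfl : a = 0 := ha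
        change (0 : B)⁻¹ = 0
        rw [← one_eq_zero, inv_one]
      lam_mem := fun b a ha => by
        obtain rfl : a = 0 := ha
        exact lam_zero b
      add_conj_mem := fun b a ha => by
        obtain rfl : a = 0 := ha
        change b + 0 + -b = 0
        simp
      mul_conj_mem := fun b a ha => by
        obtain rfl : a = 0 := ha
        change b * 0 * b⁻¹ = 0
        rw [mul_zero_eq, mul_inv_cancel, one_eq_zero] }

theorem mem_bot {x : B} : x ∈ (⊥ : BraceIdeal B) ↔ x = 0 := Iff.rfl

instance : Top (BraceIdeal B) where
  top :=
    { (⊤ : AddSubgroup B) with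
      mul_mem := fun _ _ => trivial
      inv_mem := fun _ => trivial
      lam_mem := fun _ _ _ => trivial
      add_conj_mem := fun _ _ _ => trivial
      mul_conj_mem := fun _ _ _ => trivial }

theorem mem_top {x : B} : x ∈ (⊤ : BraceIdeal B) := trivial

instance : Min (BraceIdeal B) where
  min I J :=
    { I.toAddSubgroup ⊓ J.toAddSubgroup with
      mul_mem := fun ha hb => ⟨I.mul_mem ha.1 hb.1, J.mul_mem ha.2 hb.2⟩
      inv_mem := fun ha => ⟨I.inv_mem ha.1, J.inv_mem ha.2⟩
      lam_mem := fun b _ ha => ⟨I.lam_mem b ha.1, J.lam_mem b ha.2⟩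
      add_conj_mem := fun b _ ha => ⟨I.add_conj_mem b ha.1, J.add_conj_mem b ha.2⟩
      mul_conj_mem := fun b _ ha => ⟨I.mul_conj_mem b ha.1, J.mul_conj_mem b ha.2⟩ }

theorem mem_inf {I J : BraceIdeal B} {x : B} : x ∈ I ⊓ J ↔ x ∈ I ∧ x ∈ J := Iff.rfl

/-- The preimage in `B` of an ideal of `B / I`. -/
def comap (I : BraceIdeal B) (J : BraceIdeal I.Quot) : BraceIdeal B where
  toAddSubgroup := J.toAddSubgroup.comap I.proj
  mul_mem := fun ha hb => J.mul_mem ha hb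
  inv_mem := fun ha => J.inv_mem ha
  lam_mem := fun b a ha => by
    change I.proj (lam b a) ∈ J
    rw [proj_lam]; exact J.lam_mem _ ha
  add_conj_mem := fun b a ha => by
    change I.proj (b + a + -b) ∈ J
    rw [map_add, map_add, map_neg]; exact J.add_conj_mem _ ha
  mul_conj_mem := fun b a ha => J.mul_conj_mem (I.proj b) ha

theorem mem_comap {I : BraceIdeal B} {J : BraceIdeal I.Quot} {x : B} :
    x ∈ I.comap J ↔ I.proj x ∈ J := Iff.rfl

theorem comap_bot (I : BraceIdeal B) : I.comap ⊥ = I :=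
  SetLike.ext fun _ => I.proj_eq_zero

/-- The image of an ideal in the quotient `B / I`. -/
def map (I J : BraceIdeal B) : BraceIdeal I.Quot where
  toAddSubgroup := J.toAddSubgroup.map I.proj
  mul_mem := by
    rintro _ _ ⟨a, ha, rfl⟩ ⟨b, hb, rfl⟩
    exact ⟨a * b, J.mul_mem ha hb, rfl⟩
  inv_mem := by
    rintro _ ⟨a, ha, rfl⟩
    exact ⟨a⁻¹, J.inv_mem ha, rfl⟩
  lam_mem := by
    rintro b _ ⟨a, ha, rfl⟩
    obtain ⟨b, rfl⟩ := I.proj_surjective b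
    exact ⟨lam b a, J.lam_mem b ha, I.proj_lam b a⟩
  add_conj_mem := by
    rintro b _ ⟨a, ha, rfl⟩
    obtain ⟨b, rfl⟩ := I.proj_surjective b
    exact ⟨b + a + -b, J.add_conj_mem b ha, by simp⟩
  mul_conj_mem := by
    rintro b _ ⟨a, ha, rfl⟩
    obtain ⟨b, rfl⟩ := I.proj_surjective b
    exact ⟨b * a * b⁻¹, J.mul_conj_mem b ha, rfl⟩

theorem comap_map {I J : BraceIdeal B} (h : I ≤ J) : I.comap (I.map J) = J := by
  refine SetLike.ext fun x => ⟨?_, fun hx => (⟨x, hx, rfl⟩ : ∃ y, y ∈ J ∧ I.proj y = I.proj x)⟩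
  rintro ⟨y, hy, hxy⟩
  have := J.add_mem hy (h (I.proj_eq_proj.1 hxy))
  rwa [add_neg_cancel_left] at this

theorem exists_comap_eq {I J : BraceIdeal B} (h : I ≤ J) : ∃ J' : BraceIdeal I.Quot, J = I.comap J' :=
  ⟨_, (comap_map h).symm⟩

theorem comap_le_comap {I : BraceIdeal B} {J K : BraceIdeal I.Quot} :
    I.comap J ≤ I.comap K ↔ J ≤ K := by
  refine ⟨fun h x hx => ?_, fun h x hx => h hx⟩
  obtain ⟨x, rfl⟩ := I.proj_surjective x
  exact h hx

theorem neg_add_lam_mem (I : BraceIdeal B) {x : B} (hx : x ∈ I) (b : B) : -b + lam x b ∈ I := by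
  rw [← proj_eq_proj, proj_lam, I.proj_eq_zero.2 hx, ← one_eq_zero, lam_one]

/-- A `λ`-invariant additive subgroup contained in the socle is an ideal. -/
def ofSocle (S : AddSubgroup B) (hlam : ∀ (b : B) {x : B}, x ∈ S → lam b x ∈ S)
    (hS : (S : Set B) ⊆ socle B) : BraceIdeal B where
  toAddSubgroup := S
  lam_mem := fun b _ hx => hlam b hx
  mul_mem := fun {a b} ha hb => by rw [mul_eq_add_lam]; exact S.add_mem ha (hlam a hb)
  inv_mem := fun {a} ha => by rw [inv_eq_lam]; exact hlam _ (S.neg_mem ha)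
  add_conj_mem := fun b a ha => by
    rw [AddSubgroup.mem_center_iff.1 (hS ha).2 b, add_neg_cancel_right]; exact ha
  mul_conj_mem := fun b a ha => by
    -- For `a` in the socle, multiplicative conjugation by `b` is just `λ_b`.
    have h : b * a = lam b a * b := by
      rw [mul_eq_add_lam b a, mul_eq_add_lam (lam b a) b, (hS (hlam b ha)).1 b,
        AddSubgroup.mem_center_iff.1 (hS (hlam b ha)).2 b]
    rw [h, mul_inv_cancel_right]; exact hlam b ha

theorem pow_natCard_eq_one (I : BraceIdeal B) {x : B} (hx : x ∈ I) : x ^ Nat.card I = 1 := by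
  have h := pow_card_eq_one' (x := (⟨x, hx⟩ : I.toMulSubgroup))
  exact congrArg Subtype.val h

theorem natCard_nsmul_eq_zero (I : BraceIdeal B) {x : B} (hx : x ∈ I) : Nat.card I • x = 0 := by
  have h := card_nsmul_eq_zero' (x := (⟨x, hx⟩ : I.toAddSubgroup))
  exact congrArg Subtype.val h

/-- `J / I` is infinite cyclic and contained in `Soc(B / I)`. -/
def ZStep (I J : BraceIdeal B) : Prop :=
  I ≤ J ∧ (∃ g ∈ J, (∀ n : ℤ, n • g ∈ I → n = 0) ∧ ∀ x ∈ J, ∃ n : ℤ, -(n • g) + x ∈ I) ∧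
    ∀ x ∈ J, ∀ b : B, -b + lam x b ∈ I ∧ -(b + x) + (x + b) ∈ I

/-- `J / I` has order `p`. -/
def PStep (p : ℕ) (I J : BraceIdeal B) : Prop :=
  I ≤ J ∧ I.toAddSubgroup.relIndex J.toAddSubgroup = p

/-- Steps are phrased inside `B`, without iterated quotients, so that they correspond under
preimages. Together with `comap_bot`, this reduces statements about chains above `I` to the case `I
= ⊥`. -/
theorem zstep_comap {I : BraceIdeal B} {J K : BraceIdeal I.Quot} :
    ZStep (I.comap J) (I.comap K) ↔ ZStep J K := by
  simp only [ZStep, comap_le_comap, I.proj_surjective.forall, I.proj_surjective.exists,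
    mem_comap, map_add, map_neg, map_zsmul, proj_lam]

theorem pstep_comap {p : ℕ} {I : BraceIdeal B} {J K : BraceIdeal I.Quot} :
    PStep p (I.comap J) (I.comap K) ↔ PStep p J K := by
  have h : (I.comap J).toAddSubgroup.relIndex (I.comap K).toAddSubgroup =
      J.toAddSubgroup.relIndex K.toAddSubgroup := by
    change (J.toAddSubgroup.comap I.proj).relIndex (K.toAddSubgroup.comap I.proj) = _
    rw [AddSubgroup.relIndex_comap, AddSubgroup.map_comap_eq_self_of_surjective I.proj_surjective]
  rw [PStep, PStep, comap_le_comap, h]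

theorem zstep_bot {J : BraceIdeal B} :
    ZStep ⊥ J ↔ (∃ g ∈ J, (∀ n : ℤ, n • g = 0 → n = 0) ∧ ∀ x ∈ J, ∃ n : ℤ, x = n • g) ∧
      ∀ x ∈ J, (∀ b, lam x b = b) ∧ ∀ b, x + b = b + x := by
  have h : ⊥ ≤ J := fun x hx => by rw [mem_bot.1 hx]; exact J.zero_mem
  have e : ∀ a b : B, -a + b = 0 ↔ b = a := fun a b => by rw [neg_add_eq_zero, eq_comm]
  simp only [ZStep, h, true_and, mem_bot, e, forall_and]

theorem pstep_bot {p : ℕ} {J : BraceIdeal B} : PStep p ⊥ J ↔ Nat.card J = p := by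
  have h : ⊥ ≤ J := fun x hx => by rw [mem_bot.1 hx]; exact J.zero_mem
  rw [PStep, and_iff_right h]
  exact ⟨fun h => (AddSubgroup.relIndex_bot_left _).symm.trans h,
    fun h => (AddSubgroup.relIndex_bot_left _).trans h⟩

theorem PStep.nsmul_mem {p : ℕ} {I J : BraceIdeal B} (h : PStep p I J) {x : B} (hx : x ∈ J) :
    p • x ∈ I := by
  obtain ⟨J, rfl⟩ := exists_comap_eq h.1
  have h2 : PStep p (I.comap ⊥) (I.comap J) := by rwa [comap_bot]
  rw [pstep_comap, pstep_bot] at h2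
  rw [← proj_eq_zero, map_nsmul, ← h2]
  exact J.natCard_nsmul_eq_zero hx

theorem PStep.pow_mem {p : ℕ} {I J : BraceIdeal B} (h : PStep p I J) {x : B} (hx : x ∈ J) :
    x ^ p ∈ I := by
  obtain ⟨J, rfl⟩ := exists_comap_eq h.1
  have h2 : PStep p (I.comap ⊥) (I.comap J) := by rwa [comap_bot]
  rw [pstep_comap, pstep_bot] at h2
  rw [← proj_eq_zero, proj_pow, ← h2, J.pow_natCard_eq_one hx, one_eq_zero]

theorem PStep.exists_generator {p : ℕ} (hp : p.Prime) {I J : BraceIdeal B} (h : PStep p I J) :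
    ∃ g ∈ J, g ∉ I ∧ ∀ x ∈ J, ∃ n : ℤ, -(n • g) + x ∈ I := by
  obtain ⟨J, rfl⟩ := exists_comap_eq h.1
  have h2 : PStep p (I.comap ⊥) (I.comap J) := by rwa [comap_bot]
  rw [pstep_comap, pstep_bot] at h2
  have h3 : Nat.card J.toAddSubgroup = p := h2
  have := Fact.mk hp
  obtain ⟨⟨g, hg⟩, hgen⟩ := (isAddCyclic_of_prime_card h3).exists_generator
  obtain ⟨g, rfl⟩ := I.proj_surjective g
  refine ⟨g, hg, fun h0 => ?_, fun x hx => ?_⟩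
  · have : Subsingleton J.toAddSubgroup := by
      refine subsingleton_of_forall_eq 0 fun y => ?_
      obtain ⟨n, rfl⟩ := AddSubgroup.mem_zmultiples_iff.1 (hgen y)
      refine Subtype.ext ?_
      change n • I.proj g = 0
      rw [I.proj_eq_zero.2 h0, smul_zero]
    rw [Nat.card_of_subsingleton (0 : J.toAddSubgroup)] at h3
    exact hp.one_lt.ne h3
  · obtain ⟨n, hn⟩ := AddSubgroup.mem_zmultiples_iff.1 (hgen ⟨_, hx⟩)
    have : n • I.proj g = I.proj x := congrArg Subtype.val hn
    exact ⟨n, by rw [← proj_eq_zero, map_add, map_neg, map_zsmul, this, neg_add_cancel]⟩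

end BraceIdeal

/-! ### Additive endomorphisms, powers and complements. -/

/-- `λ_b` as an endomorphism of the additive group. -/
def lamHom (b : B) : B →+ B where
  toFun := lam b
  map_zero' := lam_zero b
  map_add' := lam_add b

theorem lam_nsmul (b : B) (n : ℕ) (x : B) : lam b (n • x) = n • lam b x :=
  map_nsmul (lamHom b) n x

theorem lam_zsmul (b : B) (n : ℤ) (x : B) : lam b (n • x) = n • lam b x :=
  map_zsmul (lamHom b) n x

/-- Conjugation by `b` as an endomorphism of the additive group. -/
def addConjHom (b : B) : B →+ B where
  toFun x := b + x + -b
  map_zero' := by simp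
  map_add' x y := by simp [add_assoc]

theorem nsmul_add_conj (b : B) (n : ℕ) (x : B) : n • (b + x + -b) = b + n • x + -b :=
  (map_nsmul (addConjHom b) n x).symm

theorem pow_eq_nsmul_of_lam {k : B} (hk : lam k k = k) (n : ℕ) : k ^ n = n • k := by
  induction n with
  | zero => simp [one_eq_zero]
  | succ n ih => rw [pow_succ', ih, mul_eq_add_lam, lam_nsmul, hk, succ_nsmul']

theorem lam_pow_of_zsmul {b x : B} {n : ℤ} (h : lam b x = n • x) (m : ℕ) :
    lam (b ^ m) x = n ^ m • x := by
  induction m with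
  | zero => simp [lam_one]
  | succ m ih => rw [pow_succ, lam_mul, h, lam_zsmul, ih, ← mul_zsmul, ← pow_succ']

theorem relIndex_eq_natCard_of_complement {A : Type*} [AddGroup A]
    {H K J : AddSubgroup A} [H.Normal] (hH : H ≤ J) (hK : K ≤ J)
    (h : ∀ x ∈ J, ∃ k ∈ K, -k + x ∈ H) (hd : ∀ x ∈ K, x ∈ H → x = 0) :
    H.relIndex J = Nat.card K := by
  have hJ : K ⊔ H = J := by
    refine le_antisymm (sup_le hK hH) fun x hx => ?_
    obtain ⟨k, hk, hx⟩ := h x hx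
    have := add_mem (AddSubgroup.mem_sup_left (T := H) hk) (AddSubgroup.mem_sup_right (S := K) hx)
    rwa [add_neg_cancel_left] at this
  have hb : H ⊓ K = ⊥ := (AddSubgroup.eq_bot_iff_forall _).2 fun x hx => hd x hx.2 hx.1
  rw [← hJ, AddSubgroup.relIndex_sup_right, ← AddSubgroup.inf_relIndex_right, hb,
    AddSubgroup.relIndex_bot_left]

/-! ### Ideals of order two and infinite cyclic ideals. -/

namespace BraceIdeal

/-- The source of all centrality of `E`: `λ_b` and both conjugations are injective, preserve `E` and
fix 0, hence fix the only other element. -/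
theorem eq_of_mem_of_natCard_eq_two {E : BraceIdeal B} (h : Nat.card E = 2) {x y : B}
    (hx : x ∈ E) (hy : y ∈ E) (hx0 : x ≠ 0) (hy0 : y ≠ 0) : x = y := by
  obtain ⟨z, -, hz⟩ := (Nat.card_eq_two_iff' (⟨0, E.zero_mem⟩ : E)).1 h
  have h1 := hz ⟨x, hx⟩ fun h => hx0 (congrArg Subtype.val h)
  have h2 := hz ⟨y, hy⟩ fun h => hy0 (congrArg Subtype.val h)
  exact congrArg Subtype.val (h1.trans h2.symm)

theorem lam_eq_self_of_natCard_eq_two {E : BraceIdeal B} (h : Nat.card E = 2) {x : B}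
    (hx : x ∈ E) (b : B) : lam b x = x := by
  rcases eq_or_ne x 0 with rfl | h0
  · exact lam_zero b
  · refine eq_of_mem_of_natCard_eq_two h (E.lam_mem b hx) hx (fun h1 => h0 ?_) h0
    rw [← lam_lam_inv b⁻¹ x, inv_inv, h1, lam_zero]

theorem add_comm_of_natCard_eq_two {E : BraceIdeal B} (h : Nat.card E = 2) {x : B}
    (hx : x ∈ E) (b : B) : x + b = b + x := by
  rcases eq_or_ne x 0 with rfl | h0
  · simp
  · have := eq_of_mem_of_natCard_eq_two h (E.add_conj_mem b hx) hx (fun h1 => h0 ?_) h0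
    · nth_rw 1 [← this]; simp
    · have h2 := congrArg (fun y => -b + y + b) h1
      simpa [add_assoc] using h2

theorem mul_comm_of_natCard_eq_two {E : BraceIdeal B} (h : Nat.card E = 2) {x : B}
    (hx : x ∈ E) (b : B) : x * b = b * x := by
  rcases eq_or_ne x 0 with rfl | h0
  · rw [← one_eq_zero, one_mul, mul_one]
  · have := eq_of_mem_of_natCard_eq_two h (E.mul_conj_mem b hx) hx (fun h1 => h0 ?_) h0
    · nth_rw 1 [← this]; group
    · rw [← one_eq_zero] at h1 ⊢
      have h2 := congrArg (fun y => b⁻¹ * y * b) h1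
      simpa [mul_assoc] using h2

theorem lam_eq_of_natCard_eq_two {E : BraceIdeal B} (h : Nat.card E = 2) {x : B}
    (hx : x ∈ E) (b : B) : lam x b = b := by
  rw [lam, mul_comm_of_natCard_eq_two h hx, mul_eq_add_lam, lam_eq_self_of_natCard_eq_two h hx,
    ← add_comm_of_natCard_eq_two h hx, neg_add_cancel_left]

theorem add_self_of_natCard_eq_two {E : BraceIdeal B} (h : Nat.card E = 2) {x : B}
    (hx : x ∈ E) : x + x = 0 := by
  rw [← two_nsmul, ← h, E.natCard_nsmul_eq_zero hx]

/-- `λ_b` restricts to an automorphism of an infinite cyclic group, with inverse `λ_{b⁻¹}`, so its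
multiplier is a unit of ℤ. -/
theorem lam_eq_zsmul {J : BraceIdeal B} (h : ZStep ⊥ J) (b : B) :
    ∃ n : ℤ, (n = 1 ∨ n = -1) ∧ ∀ x ∈ J, lam b x = n • x := by
  obtain ⟨⟨g, hg, hinj, hgen⟩, -⟩ := zstep_bot.1 h
  obtain ⟨n, hn⟩ := hgen _ (J.lam_mem b hg)
  obtain ⟨m, hm⟩ := hgen _ (J.lam_mem b⁻¹ hg)
  have h1 : (m * n - 1) • g = 0 := by
    have h2 := lam_lam_inv b g
    rw [hm, lam_zsmul, hn, ← mul_zsmul'] at h2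
    rw [sub_zsmul, one_zsmul]
    rw [mul_comm] at h2
    simp [h2]
  refine ⟨n, Int.isUnit_iff.1 (IsUnit.of_mul_eq_one m (by linarith [hinj _ h1])), fun x hx => ?_⟩
  obtain ⟨k, rfl⟩ := hgen x hx
  rw [lam_zsmul, hn, ← mul_zsmul, ← mul_zsmul, mul_comm]

theorem lam_mul_self_eq {J : BraceIdeal B} (h : ZStep ⊥ J) (b : B) {x : B} (hx : x ∈ J) :
    lam (b * b) x = x := by
  obtain ⟨n, hn, hb⟩ := lam_eq_zsmul h b
  rw [lam_mul, hb x hx, lam_zsmul, hb x hx]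
  rcases hn with rfl | rfl <;> simp

/-! ### Moving factors of odd prime order down the chain. -/

theorem add_comm_of_pstep {p : ℕ} (hp : p.Prime) {K J : BraceIdeal B} (h : PStep p K J)
    (hK : ∀ k ∈ K, ∀ b, k + b = b + k) {x y : B} (hx : x ∈ J) (hy : y ∈ J) : x + y = y + x := by
  obtain ⟨g, -, -, hgen⟩ := h.exists_generator hp
  obtain ⟨n, hn⟩ := hgen x hx
  obtain ⟨m, hm⟩ := hgen y hy
  have hK' : ∀ k ∈ K, ∀ b, AddCommute k b := hK
  have h1 : AddCommute (n • g + (-(n • g) + x)) (m • g + (-(m • g) + y)) :=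
    ((((AddCommute.refl g).zsmul_left n).zsmul_right m).add_right (hK' _ hm _).symm).add_left
      (hK' _ hn _)
  rw [add_neg_cancel_left, add_neg_cancel_left] at h1
  exact h1

/-- Conditions under which the `p`-torsion of `J` is an ideal complementing `K`. -/
theorem exists_torsion_complement {p : ℕ} (hp : p.Prime) {K J : BraceIdeal B} (h : PStep p K J)
    (hK : ∀ k ∈ K, (∀ b, lam k b = b) ∧ ∀ b, k + b = b + k) (htf : ∀ k ∈ K, p • k = 0 → k = 0)
    (hs : ∀ s ∈ J, s ^ p = 1 → ∀ k ∈ K, lam s k = k)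
    (hsplit : ∀ x ∈ J, ∃ k ∈ K, p • (-k + x) = 0) :
    ∃ T : BraceIdeal B, PStep p ⊥ T ∧ T ≤ J ∧ (∀ x ∈ J, ∃ k ∈ K, -k + x ∈ T) ∧
      (∀ x ∈ K, x ∈ T → x = 0) ∧ ∀ x ∈ T, p • x = 0 := by
  have hcomm : ∀ {x y : B}, x ∈ J → y ∈ J → x + y = y + x :=
    fun hx hy => add_comm_of_pstep hp h (fun k hk => (hK k hk).2) hx hy
  let S : AddSubgroup B :=
    { carrier := {x | x ∈ J ∧ p • x = 0}
      add_mem' := fun {a b} ha hb => ⟨J.add_mem ha.1 hb.1, by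
        rw [AddCommute.add_nsmul (hcomm ha.1 hb.1 : AddCommute a b), ha.2, hb.2, add_zero]⟩
      zero_mem' := ⟨J.zero_mem, nsmul_zero p⟩
      neg_mem' := fun {a} ha => ⟨J.neg_mem ha.1, by rw [neg_nsmul, ha.2, neg_zero]⟩ }
  have hlam : ∀ (b : B) {x : B}, x ∈ S → lam b x ∈ S := fun b x hx =>
    ⟨J.lam_mem b hx.1, by rw [← lam_nsmul, hx.2, lam_zero]⟩
  have hsplit' : ∀ x ∈ J, ∃ k ∈ K, -k + x ∈ S := fun x hx => by
    obtain ⟨k, hk, hkx⟩ := hsplit x hx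
    exact ⟨k, hk, J.add_mem (J.neg_mem (h.1 hk)) hx, hkx⟩
  have hSK : ∀ x ∈ S, x ∈ K → x = 0 := fun x hx hxK => htf x hxK hx.2
  have hcard : Nat.card S = p := by
    rw [← h.2]
    refine (relIndex_eq_natCard_of_complement (H := K.toAddSubgroup) h.1
      (K := S) (fun x hx => And.left hx) (fun x hx => ?_) hSK).symm
    obtain ⟨k, hk, hkx⟩ := hsplit' x hx
    refine ⟨_, hkx, ?_⟩
    have : -(-k + x) + x = k := by rw [neg_add_rev, neg_neg, ← (hK k hk).2]; simp [add_assoc]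
    rw [this]; exact hk
  have hmul : ∀ {a b : B}, a ∈ S → b ∈ S → a * b ∈ S := fun {a b} ha hb => by
    rw [mul_eq_add_lam]; exact S.add_mem ha (hlam a hb)
  have hinv : ∀ {a : B}, a ∈ S → a⁻¹ ∈ S := fun {a} ha => by
    rw [inv_eq_lam]; exact hlam _ (S.neg_mem ha)
  let S' : Subgroup B :=
    { carrier := S
      mul_mem' := hmul
      one_mem' := by rw [one_eq_zero]; exact S.zero_mem
      inv_mem' := hinv }
  -- The additive `p`-torsion is also a multiplicative group of order `p`, so its elements have
  -- trivial multiplicative `p`-th power as well.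
  have hpow : ∀ s ∈ S, s ^ p = 1 := fun s hs => by
    have h1 := pow_card_eq_one' (x := (⟨s, hs⟩ : S'))
    have h2 : Nat.card S' = p := hcard
    rw [h2] at h1
    exact congrArg Subtype.val h1
  refine ⟨{ S with
    mul_mem := hmul
    inv_mem := hinv
    lam_mem := hlam
    add_conj_mem := fun b x hx => ⟨J.add_conj_mem b hx.1, by rw [nsmul_add_conj, hx.2]; simp⟩
    mul_conj_mem := fun b x hx => ?_ }, pstep_bot.2 hcard, fun x hx => hx.1, hsplit',
    fun x hx hxT => hSK x hxT hx, fun x hx => hx.2⟩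
  -- Normality: the conjugate of `x` is a product of commuting elements `k` of `K` and `t` of `S`.
  -- Its `p`-th power is 1, so `p • k = 0`, and `K` has no `p`-torsion.
  have hx1 : x ∈ S := hx
  have hy : (b * x * b⁻¹) ^ p = 1 := by rw [conj_pow, hpow x hx]; group
  obtain ⟨k, hk, ht⟩ := hsplit' _ (J.mul_conj_mem b hx1.1)
  have e : b * x * b⁻¹ = k * (-k + b * x * b⁻¹) := by
    rw [mul_eq_add_lam k, (hK k hk).1, add_neg_cancel_left]
  set t := -k + b * x * b⁻¹ with ht_def
  have hc : Commute k t := by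
    change k * t = t * k
    rw [mul_eq_add_lam, mul_eq_add_lam, (hK k hk).1, hs t ht.1 (hpow t ht) k hk, (hK k hk).2]
  rw [e, hc.mul_pow, hpow t ht, mul_one, pow_eq_nsmul_of_lam ((hK k hk).1 k), one_eq_zero] at hy
  change b * x * b⁻¹ ∈ S
  rw [e, htf k hk hy, ← one_eq_zero, one_mul]
  exact ht

theorem exists_swap_two_prime_bot {p : ℕ} (hp : p.Prime) (hp2 : p ≠ 2) {E J : BraceIdeal B}
    (hE : PStep 2 ⊥ E) (h : PStep p E J) : ∃ T : BraceIdeal B, PStep p ⊥ T ∧ PStep 2 T J := by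
  have hc := pstep_bot.1 hE
  obtain ⟨m, rfl⟩ := hp.odd_of_ne_two hp2
  have hodd : ∀ x ∈ E, (2 * m + 1) • x = x := fun x hx => by
    rw [succ_nsmul, mul_comm, mul_nsmul', two_nsmul x, add_self_of_natCard_eq_two hc hx,
      nsmul_zero, zero_add]
  obtain ⟨T, hT, hTJ, hsplit, hd, -⟩ := exists_torsion_complement hp h
    (fun k hk => ⟨lam_eq_of_natCard_eq_two hc hk, add_comm_of_natCard_eq_two hc hk⟩)
    (fun k hk h0 => by rwa [hodd k hk] at h0)
    (fun s _ _ k hk => lam_eq_self_of_natCard_eq_two hc hk s)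
    (fun x hx => by
      have hk := h.nsmul_mem hx
      -- The witness is `p • x`: it lies in `E`, where multiplication by the odd number `p` is the
      -- identity.
      refine ⟨_, hk, ?_⟩
      rw [AddCommute.add_nsmul
        (add_comm_of_natCard_eq_two hc (E.neg_mem hk) x : AddCommute _ x), neg_nsmul,
        hodd _ hk, neg_add_cancel])
  refine ⟨T, hT, hTJ, ?_⟩
  rw [← hc]
  exact relIndex_eq_natCard_of_complement hTJ h.1 hsplit hd

theorem lam_pow_eq_add_nsmul {x b f : B} (h : lam x b = b + f) (hf : lam x f = f) (m : ℕ) :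
    lam (x ^ m) b = b + m • f := by
  induction m with
  | zero => simp [lam_one]
  | succ m ih => rw [pow_succ', lam_mul, ih, lam_add, lam_nsmul, h, hf, add_assoc, succ_nsmul']

/-- Let `k` generate `K`, let `g` generate `J` modulo `K`, and write `p • g = m • k`. If `p ∣ m`,
then `J` splits as `K` plus its `p`-torsion, which becomes the lower factor. Otherwise `J` is itself
infinite cyclic, and oddness of `p` forces it into the socle. -/
theorem exists_swap_infinite_prime_bot {p : ℕ} (hp : p.Prime) (hp2 : p ≠ 2) {K J : BraceIdeal B}
    (hK : ZStep ⊥ K) (h : PStep p K J) :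
    ZStep ⊥ J ∨ ∃ T : BraceIdeal B, PStep p ⊥ T ∧ ZStep T J := by
  have hodd := hp.odd_of_ne_two hp2
  obtain ⟨⟨k, hk, hinj, hgen⟩, hsoc⟩ := zstep_bot.1 hK
  have hcancel : ∀ n m : ℤ, n • k = m • k → n = m := fun n m hnm => by
    have := hinj (n - m) (by rw [sub_zsmul, hnm, add_neg_cancel])
    linarith
  obtain ⟨g, hg, -, hgJ⟩ := h.exists_generator hp
  obtain ⟨m, hm⟩ := hgen _ (h.nsmul_mem hg)
  have hkc : ∀ b, AddCommute k b := (hsoc k hk).2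
  by_cases hpm : (p : ℤ) ∣ m
  · right
    obtain ⟨m, rfl⟩ := hpm
    obtain ⟨T, hT, hTJ, hsplit, hd, -⟩ := exists_torsion_complement hp h hsoc
      (fun x hx h0 => by
        obtain ⟨n, rfl⟩ := hgen x hx
        rw [← natCast_zsmul, ← mul_zsmul] at h0
        have := hinj _ h0
        simp only [mul_eq_zero, Nat.cast_eq_zero, hp.ne_zero, false_or] at this
        rw [this, zero_zsmul])
      -- `s` acts on `K` by a sign whose `p`-th power is trivial; as `p` is odd, -1 can act only as
      -- the identity.
      (fun s _ hs x hx => by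
        obtain ⟨n, hn, hlam⟩ := lam_eq_zsmul hK s
        rcases hn with rfl | rfl
        · simpa using hlam x hx
        · have h1 := lam_pow_of_zsmul (hlam x hx) p
          rw [hs, lam_one, hodd.neg_one_pow] at h1
          rw [hlam x hx, ← h1])
      (fun x hx => by
        obtain ⟨n, hn⟩ := hgJ x hx
        obtain ⟨j, hj⟩ := hgen _ hn
        -- With `x = n • g + j • k` and `p • g = (p * m) • k`, this element has the same `p`-th
        -- multiple as `x`.
        refine ⟨(n * m + j) • k, K.zsmul_mem hk _, ?_⟩
        have hx' : x = n • g + j • k := by rw [← hj, add_neg_cancel_left]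
        have hpx : p • x = p • ((n * m + j) • k) := by
          rw [hx', AddCommute.add_nsmul ((hkc (n • g)).zsmul_left j).symm]
          simp only [← natCast_zsmul] at hm ⊢
          rw [← mul_zsmul, mul_comm, mul_zsmul, hm, ← mul_zsmul, ← mul_zsmul, ← mul_zsmul,
            ← add_zsmul]
          congr 1; ring
        rw [AddCommute.add_nsmul ((hkc x).zsmul_left _).neg_left, neg_nsmul, hpx, neg_add_cancel])
    refine ⟨T, hT, hTJ, ⟨k, h.1 hk, fun n hn => hinj n (hd _ (K.zsmul_mem hk n) hn),
      fun x hx => ?_⟩, fun x hx b => ?_⟩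
    · obtain ⟨y, hy, hyx⟩ := hsplit x hx
      obtain ⟨n, rfl⟩ := hgen y hy
      exact ⟨n, hyx⟩
    · obtain ⟨y, hy, hyx⟩ := hsplit x hx
      have hpx := T.proj_eq_proj.2 hyx
      constructor
      · rw [← T.proj_eq_proj, T.proj_lam, ← hpx, ← T.proj_lam, (hsoc y hy).1]
      · rw [← T.proj_eq_proj, map_add, map_add, ← hpx, ← map_add, ← map_add, (hsoc y hy).2]
  · left
    -- The Bézout relation `u * p + v * m = 1` makes `w` a generator of `J`, with `p • w = k` and `m
    -- • w = g`.
    obtain ⟨u, v, huv⟩ := (Nat.prime_iff_prime_int.1 hp).coprime_iff_not_dvd.2 hpm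
    set w := v • g + u • k with hw
    have hwJ : w ∈ J := J.add_mem (J.zsmul_mem hg v) (J.zsmul_mem (h.1 hk) u)
    have hcw : AddCommute (v • g) (u • k) := ((hkc (v • g)).zsmul_left u).symm
    rw [← natCast_zsmul] at hm
    have hpw : (p : ℤ) • w = k := by
      rw [hw, hcw.zsmul_add, ← mul_zsmul, mul_comm, mul_zsmul, hm, ← mul_zsmul, ← mul_zsmul,
        ← add_zsmul]
      convert one_zsmul k
      linarith
    have hmw : m • w = g := by
      rw [hw, hcw.zsmul_add, ← mul_zsmul, ← mul_zsmul, mul_comm m u, mul_zsmul k, ← hm, ← mul_zsmul,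
        ← add_zsmul]
      convert one_zsmul g
      linarith
    have hwgen : ∀ x ∈ J, ∃ n : ℤ, x = n • w := fun x hx => by
      obtain ⟨n, hn⟩ := hgJ x hx
      obtain ⟨j, hj⟩ := hgen _ hn
      refine ⟨n * m + j * p, ?_⟩
      rw [add_zsmul, mul_zsmul, mul_zsmul, hmw, hpw, ← hj, add_neg_cancel_left]
    have hwinj : ∀ n : ℤ, n • w = 0 → n = 0 := fun n hn => by
      apply hinj
      rw [← hpw, ← mul_zsmul, mul_comm, mul_zsmul, hn, zsmul_zero]
    refine zstep_bot.2 ⟨⟨w, hwJ, hwinj, hwgen⟩, fun x hx => ⟨fun b => ?_, fun b => ?_⟩⟩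
    · have hxw : lam x w = w := by
        obtain ⟨n, hn⟩ := hwgen _ (J.lam_mem x hwJ)
        have h1 := lam_pow_of_zsmul hn p
        have h2 : lam (x ^ p) k = n ^ p • k := by
          rw [← hpw, lam_zsmul, h1, ← mul_zsmul, ← mul_zsmul, mul_comm]
        rw [(hsoc _ (h.pow_mem hx)).1] at h2
        have h3 : n ^ p = 1 := hcancel _ _ (by rw [← h2, one_zsmul])
        have h4 : n = 1 := by
          rcases Int.isUnit_iff.1 (IsUnit.of_pow_eq_one h3 hp.ne_zero) with h4 | rfl
          · exact h4
          · rw [hodd.neg_one_pow] at h3; norm_num at h3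
        rw [hn, h4, one_zsmul]
      -- The defect `f` lies in `J` and is fixed by `λ_x`; iterating `p` times gives `p • f = 0`,
      -- and `J` is torsion-free.
      obtain ⟨f, hf⟩ : ∃ f, f = -b + lam x b := ⟨_, rfl⟩
      have hfJ : f ∈ J := hf ▸ J.neg_add_lam_mem hx b
      obtain ⟨j, rfl⟩ := hwgen f hfJ
      have h1 : lam x b = b + j • w := by rw [hf, add_neg_cancel_left]
      have h2 := lam_pow_eq_add_nsmul h1 (by rw [lam_zsmul, hxw]) p
      rw [(hsoc _ (h.pow_mem hx)).1] at h2
      have h3 : p • (j • w) = 0 := by simpa using h2.symm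
      rw [← natCast_zsmul, ← mul_zsmul] at h3
      have h4 := hwinj _ h3
      simp only [mul_eq_zero, Nat.cast_eq_zero, hp.ne_zero, false_or] at h4
      rw [h1, h4, zero_zsmul, add_zero]
    · have hwb : AddCommute w b := by
        obtain ⟨n, hn⟩ := hwgen _ (J.add_conj_mem b hwJ)
        have h1 : b + k + -b = n • k := by
          have := map_zsmul (addConjHom b) p w
          rw [hpw] at this
          change b + k + -b = (p : ℤ) • (b + w + -b) at this
          rw [this, hn, ← hpw, ← mul_zsmul, ← mul_zsmul, mul_comm]
        rw [← (hkc b).eq, add_neg_cancel_right] at h1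
        have h2 : n = 1 := hcancel _ _ (by rw [← h1, one_zsmul])
        rw [h2, one_zsmul] at hn
        change w + b = b + w
        nth_rw 1 [← hn]
        rw [neg_add_cancel_right]
      obtain ⟨n, rfl⟩ := hwgen x hx
      exact hwb.zsmul_left n

end BraceIdeal

namespace BraceIdeal

theorem exists_swap_two_prime {p : ℕ} (hp : p.Prime) (hp2 : p ≠ 2) {I K J : BraceIdeal B}
    (hK : PStep 2 I K) (h : PStep p K J) : ∃ T : BraceIdeal B, PStep p I T ∧ PStep 2 T J := by
  obtain ⟨J, rfl⟩ := exists_comap_eq (hK.1.trans h.1)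
  obtain ⟨K, rfl⟩ := exists_comap_eq hK.1
  have hK' : PStep 2 (I.comap ⊥) (I.comap K) := by rwa [comap_bot]
  obtain ⟨T, h1, h2⟩ := exists_swap_two_prime_bot hp hp2 (pstep_comap.1 hK') (pstep_comap.1 h)
  refine ⟨I.comap T, ?_, pstep_comap.2 h2⟩
  have := pstep_comap.2 h1
  rwa [comap_bot] at this

theorem exists_swap_infinite_prime {p : ℕ} (hp : p.Prime) (hp2 : p ≠ 2) {I K J : BraceIdeal B}
    (hK : ZStep I K) (h : PStep p K J) :
    ZStep I J ∨ ∃ T : BraceIdeal B, PStep p I T ∧ ZStep T J := by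
  obtain ⟨J, rfl⟩ := exists_comap_eq (hK.1.trans h.1)
  obtain ⟨K, rfl⟩ := exists_comap_eq hK.1
  have hK' : ZStep (I.comap ⊥) (I.comap K) := by rwa [comap_bot]
  rcases exists_swap_infinite_prime_bot hp hp2 (zstep_comap.1 hK') (pstep_comap.1 h) with
    h1 | ⟨T, h1, h2⟩
  · left
    have := zstep_comap.2 h1
    rwa [comap_bot] at this
  · refine Or.inr ⟨I.comap T, ?_, zstep_comap.2 h2⟩
    have := pstep_comap.2 h1
    rwa [comap_bot] at this

/-! ### Doubling infinite cyclic factors, and sinking them below factors of order two. -/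

/-- If `J` is additively commutative and its doubles lie in the socle, they form an ideal. -/
theorem exists_double {J : BraceIdeal B} (hcomm : ∀ x ∈ J, ∀ y ∈ J, x + y = y + x)
    (hsoc : ∀ y ∈ J, y + y ∈ socle B) :
    ∃ M : BraceIdeal B, ∀ x, x ∈ M ↔ ∃ y ∈ J, x = y + y :=
  ⟨ofSocle
    { carrier := {x | ∃ y ∈ J, x = y + y}
      add_mem' := by
        rintro _ _ ⟨y, hy, rfl⟩ ⟨z, hz, rfl⟩
        refine ⟨y + z, J.add_mem hy hz, ?_⟩
        rw [add_assoc y z, ← add_assoc z y, hcomm z hz y hy]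
        simp only [add_assoc]
      zero_mem' := ⟨0, J.zero_mem, (add_zero 0).symm⟩
      neg_mem' := by
        rintro _ ⟨y, hy, rfl⟩
        exact ⟨-y, J.neg_mem hy, neg_add_rev y y⟩ }
    (by
      rintro b _ ⟨y, hy, rfl⟩
      exact ⟨lam b y, J.lam_mem b hy, lam_add b y y⟩)
    (by
      rintro _ ⟨y, hy, rfl⟩
      exact hsoc y hy), fun _ => Iff.rfl⟩

theorem exists_double_of_zstep_bot {J : BraceIdeal B} (h : ZStep ⊥ J) :
    ∃ M : BraceIdeal B, ZStep ⊥ M ∧ PStep 2 M J ∧ ∀ x, x ∈ M ↔ ∃ y ∈ J, x = y + y := by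
  obtain ⟨⟨g, hg, hinj, hgen⟩, hsoc⟩ := zstep_bot.1 h
  obtain ⟨M, hM⟩ := exists_double (fun x hx y _ => (hsoc x hx).2 y) fun y hy =>
    ⟨(hsoc _ (J.add_mem hy hy)).1,
      AddSubgroup.mem_center_iff.2 fun b => ((hsoc _ (J.add_mem hy hy)).2 b).symm⟩
  have hMJ : M ≤ J := fun x hx => by
    obtain ⟨y, hy, rfl⟩ := (hM x).1 hx
    exact J.add_mem hy hy
  have hmem : ∀ n : ℤ, n • g ∈ M ↔ Even n := fun n => by
    rw [hM]
    constructor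
    · rintro ⟨y, hy, hn⟩
      obtain ⟨m, rfl⟩ := hgen y hy
      refine ⟨m, ?_⟩
      have := hinj (n - (m + m)) (by rw [sub_zsmul, add_zsmul, hn, add_neg_cancel])
      linarith
    · rintro ⟨m, rfl⟩
      exact ⟨m • g, J.zsmul_mem hg m, add_zsmul g m m⟩
  refine ⟨M, zstep_bot.2 ⟨⟨g + g, (hM _).2 ⟨g, hg, rfl⟩, fun n hn => ?_, fun x hx => ?_⟩,
    fun x hx => hsoc x (hMJ hx)⟩, ⟨hMJ, ?_⟩, hM⟩
  · rw [← two_zsmul, ← mul_zsmul] at hn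
    have := hinj _ hn
    omega
  · obtain ⟨y, hy, rfl⟩ := (hM x).1 hx
    obtain ⟨n, rfl⟩ := hgen y hy
    exact ⟨n, ((AddCommute.refl g).zsmul_add n).symm⟩
  · refine AddSubgroup.relIndex_eq_two_iff.2 ⟨g, hg, fun b hb => ?_⟩
    obtain ⟨n, rfl⟩ := hgen b hb
    have h1 : n • g + g = (n + 1) • g := by rw [add_zsmul, one_zsmul]
    change Xor (n • g + g ∈ M) (n • g ∈ M)
    rw [h1, hmem, hmem, Int.even_add_one]
    by_cases hn : Even n <;> simp [Xor, hn]

theorem exists_double_of_zstep {I J : BraceIdeal B} (h : ZStep I J) :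
    ∃ M : BraceIdeal B, ZStep I M ∧ PStep 2 M J ∧ ∀ x, x ∈ M ↔ ∃ y ∈ J, -(y + y) + x ∈ I := by
  obtain ⟨J, rfl⟩ := exists_comap_eq h.1
  have h' : ZStep (I.comap ⊥) (I.comap J) := by rwa [comap_bot]
  obtain ⟨M, h1, h2, h3⟩ := exists_double_of_zstep_bot (zstep_comap.1 h')
  have h4 := zstep_comap.2 h1
  rw [comap_bot] at h4
  refine ⟨I.comap M, h4, pstep_comap.2 h2, fun x => ?_⟩
  simp only [mem_comap, h3, I.proj_surjective.exists, ← I.proj_eq_proj, map_add, eq_comm]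

/-- Elements of `J` act trivially and commute with `B` only up to an error in `E`. The error is
central of exponent 2, so doubling removes it: `M` consists of the doubles of elements of `J`, and
`M'` is `M + E`. -/
theorem exists_sink_zstep_bot {E J : BraceIdeal B} (hE : PStep 2 ⊥ E) (h : ZStep E J) :
    ∃ M M' : BraceIdeal B, ZStep ⊥ M ∧ PStep 2 M M' ∧ PStep 2 M' J := by
  have hc := pstep_bot.1 hE
  obtain ⟨hEJ, ⟨g, hg, hinj, hgen⟩, hsoc⟩ := h
  have hEc : ∀ x ∈ E, ∀ b, AddCommute x b := fun x hx => add_comm_of_natCard_eq_two hc hx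
  have hEE : ∀ x ∈ E, x + x = 0 := fun x hx => add_self_of_natCard_eq_two hc hx
  have hlift : ∀ x ∈ J, ∃ n : ℤ, ∃ e ∈ E, x = n • g + e := fun x hx => by
    obtain ⟨n, hn⟩ := hgen x hx
    exact ⟨n, _, hn, by rw [add_neg_cancel_left]⟩
  have hdouble : ∀ n : ℤ, ∀ e ∈ E, (n • g + e) + (n • g + e) = n • (g + g) := fun n e he => by
    rw [(AddCommute.refl g).zsmul_add, add_assoc, ← add_assoc e, (hEc e he (n • g)).eq, add_assoc,
      hEE e he, add_zero]
  have hJ : ∀ x ∈ J, ∀ y ∈ J, x + y = y + x := fun x hx y hy => by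
    obtain ⟨n, e, he, rfl⟩ := hlift x hx
    obtain ⟨m, f, hf, rfl⟩ := hlift y hy
    exact ((((AddCommute.refl g).zsmul_left n).zsmul_right m).add_right (hEc f hf _).symm).add_left
      (hEc e he _)
  have hlam2 : ∀ y ∈ J, ∀ b, lam (y + y) b = b := fun y hy b => by
    have h1 := (hsoc y hy b).1
    have h2 := (hsoc y hy y).1
    have e1 : lam (y * y) b = b := by
      obtain ⟨e, he⟩ : ∃ e, e = -b + lam y b := ⟨_, rfl⟩
      rw [← he] at h1
      have hb : lam y b = b + e := by rw [he, add_neg_cancel_left]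
      rw [lam_mul, hb, lam_add, lam_eq_self_of_natCard_eq_two hc h1, hb, add_assoc, hEE _ h1,
        add_zero]
    have e2 : y * y = (y + y) * (-y + lam y y) := by
      rw [mul_eq_add_lam (y + y), lam_eq_self_of_natCard_eq_two hc h2, add_assoc,
        add_neg_cancel_left, mul_eq_add_lam]
    rwa [e2, lam_mul, lam_eq_of_natCard_eq_two hc h2] at e1
  have hcomm2 : ∀ y ∈ J, ∀ b, b + (y + y) = (y + y) + b := fun y hy b => by
    have h1 := (hsoc y hy b).2
    obtain ⟨e, he⟩ : ∃ e, e = -(b + y) + (y + b) := ⟨_, rfl⟩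
    rw [← he] at h1
    have h2 : y + b = b + y + e := by rw [he, add_neg_cancel_left]
    symm
    calc y + y + b = y + (b + y + e) := by rw [add_assoc, h2]
      _ = (y + b) + (y + e) := by simp only [add_assoc]
      _ = b + y + (e + (y + e)) := by rw [h2]; simp only [add_assoc]
      _ = b + (y + y) := by
        rw [(hEc e h1 (y + e)).eq, add_assoc y, hEE e h1, add_zero, add_assoc]
  obtain ⟨M, hM⟩ := exists_double hJ fun y hy =>
    ⟨hlam2 y hy, AddSubgroup.mem_center_iff.2 (hcomm2 y hy)⟩
  obtain ⟨M', -, hM'J, hM'⟩ := exists_double_of_zstep (I := E) (J := J)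
    ⟨hEJ, ⟨g, hg, hinj, hgen⟩, hsoc⟩
  have hinj2 : ∀ n : ℤ, n • (g + g) ∈ E → n = 0 := fun n hn => by
    rw [← two_zsmul, ← mul_zsmul] at hn
    have := hinj _ hn
    omega
  have hMM' : M ≤ M' := fun x hx => by
    obtain ⟨y, hy, rfl⟩ := (hM x).1 hx
    exact (hM' _).2 ⟨y, hy, by rw [neg_add_cancel]; exact E.zero_mem⟩
  have hEM' : E ≤ M' := fun x hx => (hM' _).2 ⟨0, J.zero_mem, by simpa using hx⟩
  refine ⟨M, M', zstep_bot.2 ⟨⟨g + g, (hM _).2 ⟨g, hg, rfl⟩, fun n hn => ?_, fun x hx => ?_⟩,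
    fun x hx => ?_⟩, ⟨hMM', ?_⟩, hM'J⟩
  · exact hinj2 n (by rw [hn]; exact E.zero_mem)
  · obtain ⟨y, hy, rfl⟩ := (hM x).1 hx
    obtain ⟨n, e, he, rfl⟩ := hlift y hy
    exact ⟨n, hdouble n e he⟩
  · obtain ⟨y, hy, rfl⟩ := (hM x).1 hx
    exact ⟨hlam2 y hy, fun b => (hcomm2 y hy b).symm⟩
  · rw [← hc]
    refine relIndex_eq_natCard_of_complement (K := E.toAddSubgroup) hMM' hEM' (fun x hx => ?_)
      fun x hx hxM => ?_
    · obtain ⟨y, hy, hyx⟩ := (hM' x).1 hx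
      refine ⟨_, hyx, (hM _).2 ⟨y, hy, ?_⟩⟩
      have h1 : x = y + y + (-(y + y) + x) := by rw [add_neg_cancel_left]
      nth_rw 2 [h1]
      rw [← (hEc _ hyx (y + y)).eq, neg_add_cancel_left]
    · obtain ⟨y, hy, rfl⟩ := (hM x).1 hxM
      obtain ⟨n, e, he, rfl⟩ := hlift y hy
      rw [hdouble n e he] at hx ⊢
      rw [hinj2 n hx, zero_zsmul]

theorem exists_sink_zstep {I K J : BraceIdeal B} (hK : PStep 2 I K) (h : ZStep K J) :
    ∃ M M' : BraceIdeal B, ZStep I M ∧ PStep 2 M M' ∧ PStep 2 M' J := by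
  obtain ⟨J, rfl⟩ := exists_comap_eq (hK.1.trans h.1)
  obtain ⟨K, rfl⟩ := exists_comap_eq hK.1
  have hK' : PStep 2 (I.comap ⊥) (I.comap K) := by rwa [comap_bot]
  obtain ⟨M, M', h1, h2, h3⟩ := exists_sink_zstep_bot (pstep_comap.1 hK') (zstep_comap.1 h)
  refine ⟨I.comap M, I.comap M', ?_, pstep_comap.2 h2, pstep_comap.2 h3⟩
  have := zstep_comap.2 h1
  rwa [comap_bot] at this

/-! ### Rearranging whole chains. -/

/-- `I` and `J` are joined by a chain of ideals whose factors have order two. -/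
abbrev TwoChain : BraceIdeal B → BraceIdeal B → Prop := Relation.ReflTransGen (PStep 2)

/-- `I` and `J` are joined by a chain of ideals whose factors have order two, or are infinite
cyclic and contained in the socle. -/
abbrev ZTwoChain : BraceIdeal B → BraceIdeal B → Prop :=
  Relation.ReflTransGen fun I J => ZStep I J ∨ PStep 2 I J

theorem TwoChain.exists_sink_zstep {I K J : BraceIdeal B} (h : TwoChain I K) (hz : ZStep K J) :
    ∃ M, ZStep I M ∧ TwoChain M J := by
  induction h using Relation.ReflTransGen.head_induction_on with
  | refl => exact ⟨J, hz, .refl⟩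
  | head h _ ih =>
    obtain ⟨M, hM, hMJ⟩ := ih
    obtain ⟨M₁, M₂, h1, h2, h3⟩ := BraceIdeal.exists_sink_zstep h hM
    exact ⟨M₁, h1, .head h2 (.head h3 hMJ)⟩

theorem TwoChain.exists_relIndex_eq {I J : BraceIdeal B} (h : TwoChain I J) :
    I ≤ J ∧ ∃ k : ℕ, I.toAddSubgroup.relIndex J.toAddSubgroup = 2 ^ k := by
  induction h with
  | refl => exact ⟨le_rfl, 0, AddSubgroup.relIndex_self _⟩
  | tail _ h ih =>
    obtain ⟨hle, k, hk⟩ := ih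
    refine ⟨hle.trans h.1, k + 1, ?_⟩
    rw [← AddSubgroup.relIndex_mul_relIndex _ _ _ hle h.1, hk, h.2, pow_succ]

/-- Climbing the chain, each new infinite cyclic factor is sunk to lie directly above `N`, and `N`
is then enlarged by its doubles only. -/
theorem ZTwoChain.exists_twoChain_le {J : BraceIdeal B} (h : ZTwoChain ⊥ J) (H : Subgroup B)
    (hH : ∀ x, x * x ∈ H) : ∃ N : BraceIdeal B, (∀ x ∈ N, x ∈ H) ∧ TwoChain N J := by
  induction h with
  | refl =>
    refine ⟨⊥, fun x hx => ?_, .refl⟩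
    rw [mem_bot.1 hx, ← one_eq_zero]
    exact H.one_mem
  | tail _ h ih =>
    obtain ⟨N, hN, hNK⟩ := ih
    rcases h with h | h
    · obtain ⟨M, hNM, hMJ⟩ := hNK.exists_sink_zstep h
      obtain ⟨M', h1, h2, h3⟩ := exists_double_of_zstep hNM
      refine ⟨M', fun x hx => ?_, .head h2 hMJ⟩
      obtain ⟨y, hy, hyx⟩ := (h3 x).1 hx
      -- As `M / N` lies in the socle, `λ_y` fixes `y` modulo `N`, so doubles are squares there.
      have h4 : N.proj (y * y) = N.proj x := by
        rw [← N.proj_eq_proj.2 hyx, mul_eq_add_lam, map_add, map_add,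
          ← N.proj_eq_proj.2 (hNM.2.2 y hy y).1]
      rw [← mul_inv_cancel_left (y * y) x]
      exact H.mul_mem (hH y) (hN _ (N.proj_eq_proj_mul.1 h4))
    · exact ⟨N, hN, hNK.tail h⟩

theorem ZTwoChain.or_exists_nsmul_eq_zero {p : ℕ} (hp : p.Prime) (hp2 : p ≠ 2)
    {I J : BraceIdeal B} (h : ZTwoChain ⊥ I) (hIJ : PStep p I J) :
    ZTwoChain ⊥ J ∨ ∃ x : B, x ≠ 0 ∧ p • x = 0 := by
  induction h generalizing J with
  | refl =>
    obtain ⟨g, hg, hg0, -⟩ := hIJ.exists_generator hp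
    exact Or.inr ⟨g, hg0, hIJ.nsmul_mem hg⟩
  | tail hI h ih =>
    rcases h with h | h
    · rcases exists_swap_infinite_prime hp hp2 h hIJ with h1 | ⟨T, h1, h2⟩
      · exact Or.inl (hI.tail (.inl h1))
      · exact (ih h1).imp_left fun h3 => h3.tail (.inl h2)
    · obtain ⟨T, h1, h2⟩ := exists_swap_two_prime hp hp2 h hIJ
      exact (ih h1).imp_left fun h3 => h3.tail (.inr h2)

/-! ### Central chains and the Fitting ideal. -/

/-- The elements of `J` are, modulo `I`, central in `N`. -/
def CentralStep (N I J : BraceIdeal B) : Prop :=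
  I ≤ J ∧ ∀ x ∈ J, ∀ y ∈ N, I.proj (lam x y) = I.proj y ∧ I.proj (y + x) = I.proj (x + y) ∧
    I.proj (y * x) = I.proj (x * y)

theorem PStep.centralStep {I J : BraceIdeal B} (h : PStep 2 I J) (N : BraceIdeal B) :
    CentralStep N I J := by
  refine ⟨h.1, fun x hx y _ => ?_⟩
  obtain ⟨J, rfl⟩ := exists_comap_eq h.1
  have h' : PStep 2 (I.comap ⊥) (I.comap J) := by rwa [comap_bot]
  have hc := pstep_bot.1 (pstep_comap.1 h')
  rw [proj_lam, map_add, map_add, proj_mul, proj_mul]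
  exact ⟨lam_eq_of_natCard_eq_two hc hx _, (add_comm_of_natCard_eq_two hc hx _).symm,
    (mul_comm_of_natCard_eq_two hc hx _).symm⟩

/-- The socle condition leaves only multiplicative commutation to check, and since `y * x = y +
λ_y(x)`, trivial action of `N` on `J / I` suffices. -/
theorem ZStep.centralStep {I J : BraceIdeal B} (h : ZStep I J) {N : BraceIdeal B}
    (hN : ∀ b ∈ N, ∀ x ∈ J, I.proj (lam b x) = I.proj x) : CentralStep N I J := by
  refine ⟨h.1, fun x hx y hy => ?_⟩
  have h1 : I.proj (lam x y) = I.proj y := (I.proj_eq_proj.2 (h.2.2 x hx y).1).symm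
  have h2 : I.proj (y + x) = I.proj (x + y) := I.proj_eq_proj.2 (h.2.2 x hx y).2
  refine ⟨h1, h2, ?_⟩
  rw [mul_eq_add_lam, mul_eq_add_lam, map_add, map_add, hN y hy x hx, h1, ← map_add, ← map_add, h2]

theorem CentralStep.inf {N I J : BraceIdeal B} (h : CentralStep N I J) :
    CentralStep N (N ⊓ I) (N ⊓ J) := by
  refine ⟨fun x hx => ⟨hx.1, h.1 hx.2⟩, fun x hx y hy => ?_⟩
  obtain ⟨h1, h2, h3⟩ := h.2 x hx.2 y hy
  have key : ∀ {a b : B}, a ∈ N → b ∈ N → I.proj a = I.proj b →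
      (N ⊓ I).proj a = (N ⊓ I).proj b := fun ha hb hab =>
    (N ⊓ I).proj_eq_proj.2 ⟨N.add_mem (N.neg_mem ha) hb, I.proj_eq_proj.1 hab⟩
  exact ⟨key (N.lam_mem x hy) hy h1, key (N.add_mem hy hx.1) (N.add_mem hx.1 hy) h2,
    key (N.mul_mem hy hx.1) (N.mul_mem hx.1 hy) h3⟩

theorem ZStep.proj_lam_mul_self {I J : BraceIdeal B} (h : ZStep I J) (b : B) {x : B}
    (hx : x ∈ J) : I.proj (lam (b * b) x) = I.proj x := by
  obtain ⟨J, rfl⟩ := exists_comap_eq h.1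
  have h' : ZStep (I.comap ⊥) (I.comap J) := by rwa [comap_bot]
  rw [proj_lam, proj_mul]
  exact lam_mul_self_eq (zstep_comap.1 h') _ hx

/-- The elements acting trivially on `J / I` through `λ`. -/
def lamStabilizer (I J : BraceIdeal B) : Subgroup B where
  carrier := {b | ∀ x ∈ J, I.proj (lam b x) = I.proj x}
  mul_mem' {a b} ha hb x hx := by rw [lam_mul, ha _ (J.lam_mem b hx), hb x hx]
  one_mem' x _ := by rw [lam_one]
  inv_mem' {b} hb x hx := by
    rw [← hb _ (J.lam_mem b⁻¹ hx), lam_lam_inv]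

theorem ZTwoChain.exists_stabilizer {J : BraceIdeal B} (h : ZTwoChain ⊥ J) :
    ∃ H : Subgroup B, (∀ x, x * x ∈ H) ∧ ∀ N : BraceIdeal B, (∀ x ∈ N, x ∈ H) →
      Relation.ReflTransGen (CentralStep N) ⊥ (N ⊓ J) := by
  induction h with
  | refl =>
    refine ⟨⊤, fun x => trivial, fun N _ => ?_⟩
    have : N ⊓ ⊥ = ⊥ := SetLike.ext fun x =>
      mem_inf.trans ⟨And.right, fun hx => ⟨by rw [mem_bot.1 hx]; exact N.zero_mem, hx⟩⟩
    rw [this]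
  | @tail I J _ h ih =>
    obtain ⟨H, hH, hN⟩ := ih
    rcases h with h | h
    · exact ⟨H ⊓ lamStabilizer I J,
        fun x => ⟨hH x, fun y hy => h.proj_lam_mul_self x hy⟩, fun N hNH =>
        (hN N fun x hx => (hNH x hx).1).tail (h.centralStep fun b hb => (hNH b hb).2).inf⟩
    · exact ⟨H, hH, fun N hNH => (hN N hNH).tail (h.centralStep N).inf⟩

theorem exists_chain_of_reflTransGen {α : Type*} {r : α → α → Prop} {a b : α}
    (h : Relation.ReflTransGen r a b) :
    ∃ (n : ℕ) (c : ℕ → α), c 0 = a ∧ c n = b ∧ ∀ i < n, r (c i) (c (i + 1)) := by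
  induction h with
  | refl => exact ⟨0, fun _ => a, rfl, rfl, fun i hi => absurd hi (Nat.not_lt_zero i)⟩
  | @tail b d _ h ih =>
    obtain ⟨n, c, h0, hn, hc⟩ := ih
    refine ⟨n + 1, fun i => if i ≤ n then c i else d, by simpa using h0, by simp, fun i hi => ?_⟩
    rcases Nat.lt_succ_iff_lt_or_eq.1 hi with hi | rfl
    · simpa [hi.le, Nat.succ_le_of_lt hi] using hc i hi
    · simpa [hn] using h

theorem isBCentrallyNilpotent_of_reflTransGen {N : BraceIdeal B}
    (h : Relation.ReflTransGen (CentralStep N) ⊥ N) : N.IsBCentrallyNilpotent := by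
  obtain ⟨n, c, h0, hn, hc⟩ := exists_chain_of_reflTransGen h
  refine ⟨n, c, by rw [h0]; rfl, hn, fun i hi => ⟨(hc i hi).1, fun x hx => ?_⟩⟩
  set P := (c i).restrict N
  have key : ∀ a b : N, (c i).proj a = (c i).proj b → P.proj a = P.proj b := fun a b hab =>
    P.proj_eq_proj.2 ((c i).proj_eq_proj.1 hab)
  refine ⟨⟨fun q => ?_, AddSubgroup.mem_center_iff.2 fun q => ?_⟩,
    Subgroup.mem_center_iff.2 fun q => ?_⟩ <;> obtain ⟨y, rfl⟩ := P.proj_surjective q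
  · rw [← P.proj_lam]
    exact key _ _ ((hc i hi).2 x hx y y.2).1
  · rw [← map_add, ← map_add]
    exact key _ _ ((hc i hi).2 x hx y y.2).2.1
  · rw [← P.proj_mul, ← P.proj_mul]
    exact key _ _ ((hc i hi).2 x hx y y.2).2.2

theorem ZTwoChain.exists_natCard_quot_fit_eq (h : ZTwoChain (⊥ : BraceIdeal B) ⊤) :
    ∃ n : ℕ, Nat.card (fit B).Quot = 2 ^ n := by
  obtain ⟨H, hH, hcentral⟩ := h.exists_stabilizer
  obtain ⟨N, hNH, hN⟩ := h.exists_twoChain_le H hH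
  have hNtop : N ⊓ ⊤ = N := SetLike.ext fun x => mem_inf.trans (and_iff_left mem_top)
  have hc := hcentral N hNH
  rw [hNtop] at hc
  obtain ⟨-, k, hk⟩ := hN.exists_relIndex_eq
  have hk' : N.toAddSubgroup.index = 2 ^ k := by
    rw [← AddSubgroup.relIndex_top_right]; exact hk
  have hle : N.toAddSubgroup ≤ (fit B).toAddSubgroup :=
    fun x hx => le_fit (isBCentrallyNilpotent_of_reflTransGen hc) hx
  -- An infinite index would count as 0, which does not divide `2 ^ k`; finiteness is thus included.
  have hdvd : (fit B).toAddSubgroup.index ∣ 2 ^ k := hk' ▸ AddSubgroup.index_dvd_of_le hle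
  obtain ⟨m, -, hm⟩ := (Nat.dvd_prime_pow Nat.prime_two).1 hdvd
  exact ⟨m, hm⟩

/-! ### From the supersoluble chain to the theorem. -/

theorem zstep_of_factor {I J : BraceIdeal B} (hIJ : I ≤ J) (hinf : Infinite (J.factor I))
    (hcyc : IsAddCyclic (J.factor I)) (hsoc : (J.factor I : Set I.Quot) ⊆ socle I.Quot) :
    ZStep I J := by
  obtain ⟨⟨_, g, hg, rfl⟩, hgen⟩ := hcyc.exists_generator
  have hfac : ∀ x ∈ J, I.proj x ∈ J.factor I := fun x hx => ⟨x, hx, rfl⟩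
  have hord := Infinite.addOrderOf_eq_zero_of_forall_mem_zmultiples hgen
  refine ⟨hIJ, ⟨g, hg, fun n hn => ?_, fun x hx => ?_⟩, fun x hx b => ⟨?_, ?_⟩⟩
  · rw [← proj_eq_zero, map_zsmul] at hn
    have h1 : n • (⟨I.proj g, hfac g hg⟩ : J.factor I) = 0 := Subtype.ext hn
    have h2 := addOrderOf_dvd_iff_zsmul_eq_zero.2 h1
    rw [hord] at h2
    simpa using h2
  · obtain ⟨n, hn⟩ := AddSubgroup.mem_zmultiples_iff.1 (hgen ⟨_, hfac x hx⟩)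
    refine ⟨n, I.proj_eq_proj.1 ?_⟩
    rw [map_zsmul]
    exact congrArg Subtype.val hn
  · rw [← proj_eq_proj, proj_lam, (hsoc (hfac x hx)).1]
  · rw [← proj_eq_proj, map_add, map_add]
    exact AddSubgroup.mem_center_iff.1 (hsoc (hfac x hx)).2 _

theorem pstep_natCard_factor {I J : BraceIdeal B} (hIJ : I ≤ J) :
    PStep (Nat.card (J.factor I)) I J := by
  refine ⟨hIJ, ?_⟩
  have h : I.toAddSubgroup = I.proj.ker := (QuotientAddGroup.ker_mk' _).symm
  rw [h, AddSubgroup.relIndex_ker]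
  rfl

end BraceIdeal

open BraceIdeal

theorem IsSupersoluble.zTwoChain_bot_top (h : IsSupersoluble B)
    (hodd : ∀ p : ℕ, p.Prime → p ≠ 2 → ∀ x : B, p • x = 0 → x = 0) :
    ZTwoChain (⊥ : BraceIdeal B) ⊤ := by
  obtain ⟨n, c, h0, hn, hc⟩ := h
  have key : ∀ i ≤ n, ZTwoChain ⊥ (c i) := by
    intro i
    induction i with
    | zero =>
      intro _
      have : c 0 = ⊥ := SetLike.coe_injective h0
      rw [this]
    | succ i ih =>
      intro hi
      have hci := ih (Nat.le_of_succ_le hi)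
      obtain ⟨hle, ⟨h1, h2, h3⟩ | hp⟩ := hc i hi
      · exact hci.tail (.inl (zstep_of_factor hle h1 h2 h3))
      · have hstep := pstep_natCard_factor hle
        by_cases hp2 : Nat.card ((c (i + 1)).factor (c i)) = 2
        · rw [hp2] at hstep
          exact hci.tail (.inr hstep)
        · rcases hci.or_exists_nsmul_eq_zero hp hp2 hstep with h | ⟨x, hx, hpx⟩
          · exact h
          · exact absurd (hodd _ hp hp2 x hpx) hx
  have : c n = ⊤ := SetLike.coe_injective hn
  rw [← this]
  exact key n le_rfl

theorem eq_zero_of_nsmul_eq_zero_of_addU_two (h : addU B 2 = {0}) {p : ℕ} (hp : p.Prime)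
    (hp2 : p ≠ 2) {x : B} (hx : p • x = 0) : x = 0 := by
  have hmem : x ∈ addU B 2 := by
    refine ⟨isOfFinAddOrder_iff_nsmul_eq_zero.2 ⟨p, hp.pos, hx⟩, fun q hq hqx => ?_⟩
    rw [(Nat.prime_dvd_prime_iff_eq hq hp).1 (hqx.trans (addOrderOf_dvd_of_nsmul_eq_zero hx))]
    exact lt_of_le_of_ne hp.two_le hp2.symm
  rwa [h] at hmem

end SkewBrace

theorem theorem3p40 (B : Type*) [SkewBrace B] (hB : SkewBrace.IsSupersoluble B) :
    (SkewBrace.addU B 2 = {0} →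
      ∃ n : ℕ, Nat.card (SkewBrace.BraceIdeal.fit B).Quot = 2 ^ n) ∧
    ((∀ b : B, IsOfFinAddOrder b → b = 0) →
      ∃ n : ℕ, Nat.card (SkewBrace.BraceIdeal.fit B).Quot = 2 ^ n) :=
  ⟨fun h => (hB.zTwoChain_bot_top fun _ hp hp2 _ hx =>
      SkewBrace.eq_zero_of_nsmul_eq_zero_of_addU_two h hp hp2 hx).exists_natCard_quot_fit_eq,
    fun h => (hB.zTwoChain_bot_top fun p hp _ x hx =>
      h x (isOfFinAddOrder_iff_nsmul_eq_zero.2 ⟨p, hp.pos, hx⟩)).exists_natCard_quot_fit_eq⟩
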